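/- All graphs are finite, simple and undirected. Let $\Gamma$ be a connected graph with path distance $d$ and diameter $D\ge 3$. Suppose that $\Gamma$ is distance-regular, that is, there are integers $b_i$ and $c_{i+1}$ ($0\le i\le D-1$) such that for any two vertices $x,y$ with $d(x,y)=i$, the vertex $y$ has precisely $c_i$ neighbours at distance $i-1$ from $x$ and precisely $b_i$ neighbours at distance $i+1$ from $x$ (where $c_0=b_D=0$). Put $k:=b_0$ (the valency of $\Gamma$) and $a_1:=k-b_1-c_1$, and let $k=\theta_0>\theta_1>\dots>\theta_D$ be the distinct eigenvalues of the adjacency matrix of $\Gamma$, so that $\theta_1$ is the second largest eigenvalue. Call a distance-regular graph of diameter three Shilla if its second largest eigenvalue equals $\frac{a_1+\sqrt{a_1^2+4k}}{2}$, and call $\Gamma$ antipodal if "$x=y$ or $d(x,y)=D$" is an equivalence relation on its vertex set. Then $$\theta_1=\frac{a_1+\sqrt{a_1^2+4k}}{2}$$ if and only if one of the following holds: (i) $D=3$ and $\Gamma$ is Shilla; (ii) $D=4$ and $\Gamma$ is antipodal. -/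

import Mathlib

namespace SimpleGraph

/-- `G` is distance-regular with intersection numbers `b i` and `c i`: it is connected, and for any
two vertices `x, y` at distance `i` there are precisely `c i` neighbours of `y` at distance `i - 1`
from `x` and precisely `b i` neighbours of `y` at distance `i + 1` from `x`.
(No vertex has distance `-1` or `D + 1` from `x`, so the conditions force `c 0 = 0` and `b D = 0`;
the values of `b` and `c` beyond the diameter `D` are irrelevant.) -/
def IsDistanceRegularWith {V : Type*} [Fintype V] (G : SimpleGraph V) [DecidableRel G.Adj]
    (b c : ℕ → ℕ) : Prop :=
  G.Connected ∧ ∀ x y : V,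
    ((G.neighborFinset y).filter (fun z => G.dist x z + 1 = G.dist x y)).card = c (G.dist x y) ∧
    ((G.neighborFinset y).filter (fun z => G.dist x z = G.dist x y + 1)).card = b (G.dist x y)

/-- The intersection number `a i = k - b i - c i`, where `k = b 0` is the valency. -/
def intersectionA (b c : ℕ → ℕ) (i : ℕ) : ℤ := (b 0 : ℤ) - b i - c i

/-- `θ` is an eigenvalue of the graph `G`, i.e. of its adjacency matrix. (That matrix is real
symmetric, so all its eigenvalues are real.) -/
def IsGraphEigenvalue {V : Type*} [Fintype V] [DecidableEq V] (G : SimpleGraph V)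
    [DecidableRel G.Adj] (θ : ℝ) : Prop :=
  Module.End.HasEigenvalue (Matrix.toLin' (G.adjMatrix ℝ)) θ

/-- The second largest of the distinct eigenvalues `θ₀ > θ₁ > ⋯` of `G`: the largest eigenvalue
that is smaller than some other eigenvalue. -/
noncomputable def secondLargestEigenvalue {V : Type*} [Fintype V] [DecidableEq V]
    (G : SimpleGraph V) [DecidableRel G.Adj] : ℝ :=
  sSup {θ : ℝ | G.IsGraphEigenvalue θ ∧ ∃ η : ℝ, G.IsGraphEigenvalue η ∧ θ < η}

/-- The supremum in the definition of the second largest eigenvalue is a maximum as soon as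
there are two distinct eigenvalues. -/
theorem isGreatest_secondLargestEigenvalue {V : Type*} [Fintype V] [DecidableEq V]
    (G : SimpleGraph V) [DecidableRel G.Adj] {θ η : ℝ} (hθ : G.IsGraphEigenvalue θ)
    (hη : G.IsGraphEigenvalue η) (h : θ < η) :
    IsGreatest {θ : ℝ | G.IsGraphEigenvalue θ ∧ ∃ η : ℝ, G.IsGraphEigenvalue η ∧ θ < η}
      G.secondLargestEigenvalue := by
  have hfin : {θ : ℝ | G.IsGraphEigenvalue θ ∧
      ∃ η : ℝ, G.IsGraphEigenvalue η ∧ θ < η}.Finite :=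
    (Module.End.finite_hasEigenvalue (Matrix.toLin' (G.adjMatrix ℝ))).subset fun _ hx => hx.1
  have hne : {θ : ℝ | G.IsGraphEigenvalue θ ∧
      ∃ η : ℝ, G.IsGraphEigenvalue η ∧ θ < η}.Nonempty := ⟨θ, hθ, η, hη, h⟩
  exact ⟨hne.csSup_mem hfin, fun _ hx => le_csSup hfin.bddAbove hx⟩

/-- A distance-regular graph with diameter three is Shilla if its second largest eigenvalue is
`(a₁ + √(a₁² + 4k)) / 2`. (The intersection numbers occurring here are determined by `G`.) -/
def IsShilla {V : Type*} [Fintype V] [DecidableEq V] (G : SimpleGraph V)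
    [DecidableRel G.Adj] : Prop :=
  ∃ b c : ℕ → ℕ, G.IsDistanceRegularWith b c ∧ G.diam = 3 ∧
    G.secondLargestEigenvalue =
      ((intersectionA b c 1 : ℝ) + √((intersectionA b c 1 : ℝ) ^ 2 + 4 * (b 0 : ℝ))) / 2

/-- A connected graph of diameter `D` is antipodal if being equal or at distance `D` is an
equivalence relation on its vertices. -/
def IsAntipodal {V : Type*} (G : SimpleGraph V) : Prop :=
  Equivalence (fun x y : V => x = y ∨ G.dist x y = G.diam)

end SimpleGraph

/-! Let θ be the positive root of X² - a₁X - k. Since A² = k + a₁A + c₂A₂, the matrix P = (θ - a₁)I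
+ A satisfies AP = θP + c₂A₂. If d(x,y) ≥ 4, put g = P(eₓ - e_y) and u = A₂(eₓ - e_y). Then g lives
on two disjoint balls of radius one, u on the spheres of radius two, and their supports are
disjoint. So g has sum zero and Rayleigh quotient θ, which gives θ₁ ≥ θ. Equality makes g an
eigenvector, so u = 0: x and y have the same second neighbours. This forces D = 4 and antipodality.
Conversely, let D = 4 with Γ antipodal. The vertices of an antipodal class share their second
sphere, and their unit balls partition its complement. An eigenvector for some η > θ, η ≠ k, is then
constant on each class, and its zero sum makes it vanish. For D = 3 the statement is the definition
of Shilla. -/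

open Matrix

namespace SimpleGraph

section Metric

variable {V : Type*} {G : SimpleGraph V}

/-- A point on a geodesic at a prescribed distance from its start. -/
theorem Connected.exists_dist_eq_of_le (hG : G.Connected) {x y : V} {m : ℕ}
    (hm : m ≤ G.dist x y) : ∃ z, G.dist x z = m ∧ G.dist z y = G.dist x y - m := by
  obtain ⟨p, hp⟩ := hG.exists_walk_length_eq_dist x y
  refine ⟨p.getVert m, ?_⟩
  have h1 := dist_le (p.take m)
  have h2 := dist_le (p.drop m)
  have h3 := hG.dist_triangle (u := x) (v := p.getVert m) (w := y)
  simp only [Walk.take_length, Walk.drop_length] at h1 h2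
  omega

theorem Connected.exists_adj_of_dist_eq_add_one (hG : G.Connected) {x y : V} {n : ℕ}
    (h : G.dist x y = n + 1) : ∃ z, G.Adj z y ∧ G.dist x z = n := by
  obtain ⟨z, hz, hzy⟩ := hG.exists_dist_eq_of_le (x := x) (y := y) (m := n) (by omega)
  exact ⟨z, dist_eq_one_iff_adj.mp (by omega), hz⟩

end Metric

/-! ### Eigenvalues and Rayleigh quotients of regular graphs -/

section Spectrum

variable {V : Type*} [Fintype V] [DecidableEq V] {G : SimpleGraph V} [DecidableRel G.Adj]
  {k : ℕ} {η t : ℝ} {v g : V → ℝ}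

theorem isGraphEigenvalue_iff :
    G.IsGraphEigenvalue η ↔ ∃ v : V → ℝ, v ≠ 0 ∧ G.adjMatrix ℝ *ᵥ v = η • v := by
  constructor
  · intro h
    obtain ⟨v, hv⟩ := h.exists_hasEigenvector
    exact ⟨v, hv.2, by simpa using hv.apply_eq_smul⟩
  · rintro ⟨v, hv, h⟩
    exact Module.End.hasEigenvalue_of_hasEigenvector
      ⟨Module.End.mem_eigenspace_iff.mpr (by simpa using h), hv⟩

theorem IsRegularOfDegree.lapMatrix_mulVec (hk : G.IsRegularOfDegree k) :
    G.lapMatrix ℝ *ᵥ v = (k : ℝ) • v - G.adjMatrix ℝ *ᵥ v := by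
  ext x
  simp [lapMatrix_mulVec_apply, hk x]

omit [DecidableEq V] in
theorem IsRegularOfDegree.adjMatrix_mulVec_one (hk : G.IsRegularOfDegree k) :
    G.adjMatrix ℝ *ᵥ 1 = (k : ℝ) • 1 := by
  ext x
  have h := adjMatrix_mulVec_const_apply_of_regular (a := (1 : ℝ)) hk (v := x)
  rw [mul_one] at h
  simpa using h

theorem IsRegularOfDegree.isGraphEigenvalue [Nonempty V] (hk : G.IsRegularOfDegree k) :
    G.IsGraphEigenvalue k :=
  isGraphEigenvalue_iff.mpr ⟨1, one_ne_zero, hk.adjMatrix_mulVec_one⟩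

theorem IsRegularOfDegree.eigenvalue_le (hk : G.IsRegularOfDegree k)
    (hη : G.IsGraphEigenvalue η) : η ≤ k := by
  obtain ⟨v, hv, h⟩ := isGraphEigenvalue_iff.mp hη
  have h1 := (posSemidef_lapMatrix ℝ G).dotProduct_mulVec_nonneg v
  rw [hk.lapMatrix_mulVec, h, ← sub_smul, star_trivial, dotProduct_smul, smul_eq_mul] at h1
  have h2 : 0 < v ⬝ᵥ v := by simpa using dotProduct_star_self_pos_iff.mpr hv
  nlinarith

omit [DecidableEq V] in
/-- Eigenvectors of a regular graph for eigenvalues other than the valency have sum zero. -/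
theorem IsRegularOfDegree.sum_eq_zero (hk : G.IsRegularOfDegree k)
    (h : G.adjMatrix ℝ *ᵥ v = η • v) (hη : η ≠ k) : ∑ x, v x = 0 := by
  have h1 : (1 : V → ℝ) ⬝ᵥ (G.adjMatrix ℝ *ᵥ v) = (k : ℝ) * ∑ x, v x := by
    rw [dotProduct_mulVec, ← mulVec_transpose, transpose_adjMatrix, hk.adjMatrix_mulVec_one,
      smul_dotProduct, one_dotProduct, smul_eq_mul]
  rw [h, dotProduct_smul, one_dotProduct, smul_eq_mul] at h1
  by_contra h0
  exact hη (mul_right_cancel₀ h0 h1)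

/-- A vector of sum zero is not an eigenvector for the valency of a connected regular graph. -/
theorem IsRegularOfDegree.ne_of_sum_eq_zero (hk : G.IsRegularOfDegree k) (hG : G.Connected)
    (hv : v ≠ 0) (hsum : ∑ x, v x = 0) (h : G.adjMatrix ℝ *ᵥ v = η • v) : η ≠ k := by
  rintro rfl
  have h1 : G.lapMatrix ℝ *ᵥ v = 0 := by rw [hk.lapMatrix_mulVec, h, sub_self]
  rw [lapMatrix_mulVec_eq_zero_iff_forall_reachable] at h1
  apply hv
  ext x
  have h2 : ∑ y, v y = Fintype.card V * v x := by
    rw [Finset.sum_congr rfl fun y _ => h1 y x (hG y x)]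
    simp
  have : Nonempty V := ⟨x⟩
  have h3 : (Fintype.card V : ℝ) ≠ 0 := by exact_mod_cast Fintype.card_ne_zero
  rw [hsum] at h2
  simpa [h3] using h2.symm

/-- If `t` bounds all eigenvalues of a connected graph of valency `k` other than `k`, then `t` also
bounds the Rayleigh quotients of vectors of sum zero, with equality for eigenvectors only. -/
theorem IsRegularOfDegree.rayleigh_le (hk : G.IsRegularOfDegree k) (hG : G.Connected)
    (ht : ∀ η : ℝ, G.IsGraphEigenvalue η → η ≠ k → η ≤ t) (hg : ∑ x, g x = 0) :
    g ⬝ᵥ (G.adjMatrix ℝ *ᵥ g) ≤ t * (g ⬝ᵥ g) ∧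
      (g ⬝ᵥ (G.adjMatrix ℝ *ᵥ g) = t * (g ⬝ᵥ g) → G.adjMatrix ℝ *ᵥ g = t • g) := by
  have : Nonempty V := hG.nonempty
  have hn : (Fintype.card V : ℝ) ≠ 0 := by exact_mod_cast Fintype.card_ne_zero
  set J : Matrix V V ℝ := Matrix.of fun _ _ => 1 with hJ
  -- This multiple of J puts the all-ones vector in the kernel of M. Eigenvectors of M for nonzero
  -- eigenvalues then have sum zero, so they are eigenvectors of A.
  set s : ℝ := (k - t) / Fintype.card V with hs
  set M : Matrix V V ℝ := t • (1 : Matrix V V ℝ) - G.adjMatrix ℝ + s • J with hM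
  have hJv (w : V → ℝ) : J *ᵥ w = (∑ x, w x) • 1 := by
    ext x
    simp [hJ, mulVec, dotProduct]
  have hMv (w : V → ℝ) : M *ᵥ w = t • w - G.adjMatrix ℝ *ᵥ w + (s * ∑ x, w x) • 1 := by
    rw [hM, add_mulVec, sub_mulVec, smul_mulVec, smul_mulVec, one_mulVec, hJv, smul_smul]
  have hM1 : M *ᵥ 1 = 0 := by
    rw [hMv, hk.adjMatrix_mulVec_one, ← sub_smul, ← add_smul]
    simp [hs, hn]
  have hsymm : Mᵀ = M := by
    ext x y
    simp [hM, hJ, one_apply, adjMatrix_apply, adj_comm, eq_comm]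
  have hherm : M.IsHermitian := by
    rw [IsHermitian, conjTranspose_eq_transpose_of_trivial, hsymm]
  have hpsd : M.PosSemidef := by
    rw [hherm.posSemidef_iff_eigenvalues_nonneg]
    intro i
    set μ := hherm.eigenvalues i with hμ
    set w : V → ℝ := ⇑(hherm.eigenvectorBasis i) with hw
    have hMw : M *ᵥ w = μ • w := hherm.mulVec_eigenvectorBasis i
    have hw0 : w ≠ 0 := by
      intro h0
      apply hherm.eigenvectorBasis.orthonormal.ne_zero i
      ext x
      exact congrFun h0 x
    by_cases hμ0 : μ = 0
    · simp [hμ0]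
    have hsum : ∑ x, w x = 0 := by
      have h1 : (1 : V → ℝ) ⬝ᵥ (M *ᵥ w) = 0 := by
        rw [dotProduct_mulVec, ← mulVec_transpose, hsymm, hM1, zero_dotProduct]
      rw [hMw, dotProduct_smul, one_dotProduct, smul_eq_mul] at h1
      exact (mul_eq_zero.mp h1).resolve_left hμ0
    rw [hMv, hsum, mul_zero, zero_smul, add_zero] at hMw
    have hA : G.adjMatrix ℝ *ᵥ w = (t - μ) • w := by
      rw [sub_smul, ← hMw]
      abel
    have := ht _ (isGraphEigenvalue_iff.mpr ⟨w, hw0, hA⟩) (hk.ne_of_sum_eq_zero hG hw0 hsum hA)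
    simp only [Pi.zero_apply]
    linarith
  have hMg : M *ᵥ g = t • g - G.adjMatrix ℝ *ᵥ g := by
    rw [hMv, hg, mul_zero, zero_smul, add_zero]
  have hq : star g ⬝ᵥ (M *ᵥ g) = t * (g ⬝ᵥ g) - g ⬝ᵥ (G.adjMatrix ℝ *ᵥ g) := by
    rw [hMg, star_trivial, dotProduct_sub, dotProduct_smul, smul_eq_mul]
  constructor
  · have := hpsd.dotProduct_mulVec_nonneg g
    linarith
  · intro h
    have := (hpsd.dotProduct_mulVec_zero_iff g).mp (by rw [hq, h, sub_self])
    rw [hMg] at this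
    exact (sub_eq_zero.mp this).symm

/-- If some nonzero vector of sum zero has Rayleigh quotient `t`, then the second largest
eigenvalue is the largest eigenvalue other than the valency, and it is at least `t`. -/
theorem IsRegularOfDegree.secondLargestEigenvalue_spec (hk : G.IsRegularOfDegree k)
    (hG : G.Connected) (hg : ∑ x, g x = 0) (hg0 : g ≠ 0)
    (hgt : g ⬝ᵥ (G.adjMatrix ℝ *ᵥ g) = t * (g ⬝ᵥ g)) :
    (G.IsGraphEigenvalue G.secondLargestEigenvalue ∧ G.secondLargestEigenvalue ≠ k) ∧
      (∀ η : ℝ, G.IsGraphEigenvalue η → η ≠ k → η ≤ G.secondLargestEigenvalue) ∧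
      t ≤ G.secondLargestEigenvalue := by
  have : Nonempty V := hG.nonempty
  have hpos : 0 < g ⬝ᵥ g := by simpa using dotProduct_star_self_pos_iff.mpr hg0
  obtain ⟨θ, hθ, hθk⟩ : ∃ θ : ℝ, G.IsGraphEigenvalue θ ∧ θ ≠ k := by
    by_contra! h
    -- Were k the only eigenvalue, every real number would bound the others, even t - 1, which g
    -- violates.
    have := (hk.rayleigh_le (t := t - 1) hG (fun η h1 h2 => absurd (h η h1) h2) hg).1
    nlinarith
  have hgr := isGreatest_secondLargestEigenvalue G hθ hk.isGraphEigenvalue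
    (lt_of_le_of_ne (hk.eigenvalue_le hθ) hθk)
  have hle : ∀ η : ℝ, G.IsGraphEigenvalue η → η ≠ k → η ≤ G.secondLargestEigenvalue :=
    fun η h1 h2 =>
      hgr.2 ⟨h1, k, hk.isGraphEigenvalue, lt_of_le_of_ne (hk.eigenvalue_le h1) h2⟩
  refine ⟨⟨hgr.1.1, ?_⟩, hle, ?_⟩
  · obtain ⟨ζ, hζ, hlt⟩ := hgr.1.2
    exact (lt_of_lt_of_le hlt (hk.eigenvalue_le hζ)).ne
  · have := (hk.rayleigh_le hG hle hg).1
    nlinarith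

end Spectrum

end SimpleGraph

/-! ### Intersection numbers and the square of the adjacency matrix -/

namespace SimpleGraph

/-- The distance-two matrix of a graph. -/
noncomputable def distTwoMatrix {V : Type*} (G : SimpleGraph V) : Matrix V V ℝ :=
  Matrix.of fun x y => if G.dist x y = 2 then 1 else 0

theorem distTwoMatrix_apply {V : Type*} (G : SimpleGraph V) (x y : V) :
    G.distTwoMatrix x y = if G.dist x y = 2 then 1 else 0 := rfl

namespace IsDistanceRegularWith

variable {V : Type*} [Fintype V] {G : SimpleGraph V} [DecidableRel G.Adj] {b c : ℕ → ℕ}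

theorem isRegularOfDegree (h : G.IsDistanceRegularWith b c) : G.IsRegularOfDegree (b 0) := by
  intro x
  have h1 := (h.2 x x).2
  rw [dist_self, Finset.filter_true_of_mem] at h1
  · exact h1
  · intro z hz
    rw [mem_neighborFinset] at hz
    exact dist_eq_one_iff_adj.mpr hz

theorem c_pos (h : G.IsDistanceRegularWith b c) {x y : V} {n : ℕ} (hxy : G.dist x y = n + 1) :
    0 < c (n + 1) := by
  obtain ⟨z, hz, hxz⟩ := h.1.exists_adj_of_dist_eq_add_one hxy
  rw [← hxy, ← (h.2 x y).1, Finset.card_pos]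
  exact ⟨z, by simp [hz.symm, hxy, hxz]⟩

/-- Whether a geodesic extends depends only on its length, through the positivity of b at that
length. -/
theorem exists_adj_dist_add_one (h : G.IsDistanceRegularWith b c) {x y u w : V}
    (hxy : G.dist x y = G.dist u w + 1) : ∃ z, G.Adj w z ∧ G.dist u z = G.dist u w + 1 := by
  obtain ⟨z, hz, hxz⟩ := h.1.exists_adj_of_dist_eq_add_one hxy
  have h1 : 0 < b (G.dist x z) := by
    rw [← (h.2 x z).2, Finset.card_pos]
    exact ⟨y, by simp [hz, hxz, hxy]⟩
  rw [hxz, ← (h.2 u w).2, Finset.card_pos] at h1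
  obtain ⟨y', hy'⟩ := h1
  exact ⟨y', by simpa using hy'⟩

/-- The number of common neighbours of two vertices. -/
theorem card_common_neighbors [DecidableEq V] (h : G.IsDistanceRegularWith b c) (x y : V) :
    (((G.neighborFinset y).filter fun z => G.dist x z = 1).card : ℝ) =
      (b 0 : ℝ) * (if x = y then 1 else 0) +
        (intersectionA b c 1 : ℝ) * (if G.dist x y = 1 then 1 else 0) +
        (c 2 : ℝ) * (if G.dist x y = 2 then 1 else 0) := by
  have hnear : ∀ z ∈ G.neighborFinset y,
      G.dist x z ≤ G.dist x y + 1 ∧ G.dist x y ≤ G.dist x z + 1 := by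
    intro z hz
    rw [mem_neighborFinset, ← dist_eq_one_iff_adj] at hz
    have h1 := h.1.dist_triangle (u := x) (v := y) (w := z)
    have h2 := h.1.dist_triangle (u := x) (v := z) (w := y)
    rw [dist_comm (u := z)] at h2
    omega
  obtain h0 | h1 | h2 | h3 : G.dist x y = 0 ∨ G.dist x y = 1 ∨ G.dist x y = 2 ∨
    3 ≤ G.dist x y := by omega
  · have hb := (h.2 x y).2
    rw [h0, zero_add] at hb
    rw [hb]
    simp [h.1.dist_eq_zero_iff.mp h0]
  · have hc := (h.2 x y).1
    have hb := (h.2 x y).2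
    have hxy : x ≠ y := by
      rintro rfl
      simp at h1
    have hdeg := h.isRegularOfDegree y
    rw [← card_neighborFinset_eq_degree] at hdeg
    have hsplit : (G.neighborFinset y).card =
        ((G.neighborFinset y).filter fun z => G.dist x z = 1).card +
        (((G.neighborFinset y).filter fun z => G.dist x z + 1 = G.dist x y).card +
        ((G.neighborFinset y).filter fun z => G.dist x z = G.dist x y + 1).card) := by
      rw [← Finset.card_union_of_disjoint, ← Finset.card_union_of_disjoint]
      · congr 1
        ext z
        have := hnear z
        simp only [Finset.mem_union, Finset.mem_filter]
        grind
      · rw [Finset.disjoint_left]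
        intro z
        simp only [Finset.mem_union, Finset.mem_filter]
        omega
      · rw [Finset.disjoint_left]
        intro z
        simp only [Finset.mem_filter]
        omega
    rw [hc, hb, hdeg, h1] at hsplit
    have hsplit' : (b 0 : ℝ) = ((G.neighborFinset y).filter fun z => G.dist x z = 1).card +
      ((c 1 : ℝ) + b 1) := by exact_mod_cast hsplit
    simp only [if_neg hxy, h1, intersectionA]
    push_cast
    linarith
  · have hc := (h.2 x y).1
    have hxy : x ≠ y := by
      rintro rfl
      simp at h2
    rw [h2] at hc
    rw [Finset.filter_congr (q := fun z => G.dist x z + 1 = 2) fun z _ => by omega, hc]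
    simp [hxy, h2, -dist_eq_one_iff_adj]
  · have hxy : x ≠ y := by
      rintro rfl
      simp at h3
    rw [Finset.filter_false_of_mem]
    · simp [hxy, show G.dist x y ≠ 1 by omega, show G.dist x y ≠ 2 by omega,
        -dist_eq_one_iff_adj]
    · intro z hz
      have := hnear z hz
      omega

theorem adjMatrix_mul_self [DecidableEq V] (h : G.IsDistanceRegularWith b c) :
    G.adjMatrix ℝ * G.adjMatrix ℝ = (b 0 : ℝ) • (1 : Matrix V V ℝ) +
      (intersectionA b c 1 : ℝ) • G.adjMatrix ℝ + (c 2 : ℝ) • G.distTwoMatrix := by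
  ext x y
  have h1 := h.card_common_neighbors x y
  simp only [dist_eq_one_iff_adj] at h1
  rw [Matrix.add_apply, Matrix.add_apply, Matrix.smul_apply, Matrix.smul_apply, Matrix.smul_apply,
    one_apply, adjMatrix_apply, distTwoMatrix_apply, smul_eq_mul, smul_eq_mul, smul_eq_mul, ← h1,
    mul_adjMatrix_apply]
  simp

end IsDistanceRegularWith

end SimpleGraph

/-! ### Equality case, and antipodal graphs of diameter four -/

namespace SimpleGraph

theorem IsAntipodal.eq_or_dist_eq {V : Type*} {G : SimpleGraph V} (h : G.IsAntipodal) {x y z : V}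
    (hxy : y = x ∨ G.dist x y = G.diam) (hxz : z = x ∨ G.dist x z = G.diam) :
    y = z ∨ G.dist y z = G.diam :=
  h.trans (h.symm (hxy.imp Eq.symm id)) (hxz.imp Eq.symm id)

namespace IsDistanceRegularWith

variable {V : Type*} [Fintype V] {G : SimpleGraph V} [DecidableRel G.Adj] {b c : ℕ → ℕ}

theorem dist_le_diam (h : G.IsDistanceRegularWith b c) (x y : V) : G.dist x y ≤ G.diam := by
  have : Nonempty V := h.1.nonempty
  exact SimpleGraph.dist_le_diam (connected_iff_ediam_ne_top.mp h.1)

/-- The difference of the positive eigenvectors of the balls of radius one around two vertices at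
distance at least four. -/
theorem exists_ball_difference [DecidableEq V] (h : G.IsDistanceRegularWith b c) {θ : ℝ}
    (hθ : θ * (θ - intersectionA b c 1) = b 0) {x y : V} (hxy : 4 ≤ G.dist x y) :
    ∃ g u : V → ℝ, ∑ z, g z = 0 ∧ g x = θ - intersectionA b c 1 ∧
      G.adjMatrix ℝ *ᵥ g = θ • g + (c 2 : ℝ) • u ∧ g ⬝ᵥ u = 0 ∧
      ∀ z, u z = (if G.dist z x = 2 then 1 else 0) - (if G.dist z y = 2 then 1 else 0) := by
  set a : ℝ := (intersectionA b c 1 : ℝ)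
  set P : Matrix V V ℝ := (θ - a) • (1 : Matrix V V ℝ) + G.adjMatrix ℝ with hP
  set e : V → ℝ := Pi.single x 1 - Pi.single y 1 with he
  have hAP : G.adjMatrix ℝ * P = θ • P + (c 2 : ℝ) • G.distTwoMatrix := by
    rw [hP, mul_add, h.adjMatrix_mul_self, mul_smul_comm, mul_one, ← hθ]
    module
  have hne : x ≠ y := by
    rintro rfl
    simp at hxy
  have hadj : ¬ G.Adj x y := fun hA => by
    rw [← dist_eq_one_iff_adj] at hA
    omega
  have hg (z : V) : (P *ᵥ e) z = (θ - a) * ((if z = x then 1 else 0) - if z = y then 1 else 0) +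
      ((if G.Adj z x then 1 else 0) - if G.Adj z y then 1 else 0) := by
    simp only [hP, he, mulVec_sub, mulVec_single_one, Pi.sub_apply, col_apply, Matrix.add_apply,
      Matrix.smul_apply, one_apply, adjMatrix_apply, smul_eq_mul]
    ring
  have hu (z : V) : (G.distTwoMatrix *ᵥ e) z =
      (if G.dist z x = 2 then 1 else 0) - (if G.dist z y = 2 then 1 else 0) := by
    simp [he, mulVec_sub, distTwoMatrix_apply]
  refine ⟨P *ᵥ e, G.distTwoMatrix *ᵥ e, ?_, ?_, ?_, ?_, hu⟩
  · have hPt : Pᵀ *ᵥ 1 = (θ - a + b 0) • 1 := by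
      rw [hP, transpose_add, transpose_smul, transpose_one, transpose_adjMatrix, add_mulVec,
        smul_mulVec, one_mulVec, h.isRegularOfDegree.adjMatrix_mulVec_one, ← add_smul]
    rw [← one_dotProduct, dotProduct_mulVec, ← mulVec_transpose, hPt, smul_dotProduct,
      one_dotProduct]
    simp [he]
  · rw [hg]
    simp [hne, hadj]
  · rw [mulVec_mulVec, hAP, add_mulVec, smul_mulVec, smul_mulVec]
  · refine Finset.sum_eq_zero fun z _ => ?_
    rw [hg, hu]
    have htri := h.1.dist_triangle (u := x) (v := z) (w := y)
    rw [dist_comm (u := x) (v := z)] at htri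
    simp only [← dist_eq_one_iff_adj, ← h.1.dist_eq_zero_iff]
    by_cases hx : G.dist z x ≤ 2
    · by_cases hx2 : G.dist z x = 2
      · simp [hx2, show G.dist z y ≠ 0 by omega, show G.dist z y ≠ 1 by omega,
          -dist_eq_one_iff_adj, -dist_eq_zero_iff_eq_or_not_reachable]
      · simp [hx2, show G.dist z y ≠ 2 by omega]
    · by_cases hy2 : G.dist z y = 2
      · simp [hy2, show G.dist z x ≠ 0 by omega, show G.dist z x ≠ 1 by omega,
          -dist_eq_one_iff_adj, -dist_eq_zero_iff_eq_or_not_reachable]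
      · simp [hy2, show G.dist z x ≠ 2 by omega]

/-- In a distance-regular graph of diameter at least four, equality in the interlacing bound on the
second largest eigenvalue forces far apart vertices to have the same second neighbours. -/
theorem dist_eq_two_iff_of_secondLargestEigenvalue_eq [DecidableEq V]
    (h : G.IsDistanceRegularWith b c) {θ : ℝ} (hθ : θ * (θ - intersectionA b c 1) = b 0)
    (hpos : 0 < θ - intersectionA b c 1) (heq : G.secondLargestEigenvalue = θ) {x y : V}
    (hxy : 4 ≤ G.dist x y) (z : V) : G.dist z x = 2 ↔ G.dist z y = 2 := by
  obtain ⟨g, u, hsum, hgx, hA, hgu, hu⟩ := h.exists_ball_difference hθ hxy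
  have hg0 : g ≠ 0 := by
    rintro rfl
    simp at hgx
    linarith
  have hgt : g ⬝ᵥ (G.adjMatrix ℝ *ᵥ g) = θ * (g ⬝ᵥ g) := by
    rw [hA, dotProduct_add, dotProduct_smul, dotProduct_smul, hgu]
    simp
  have hk := h.isRegularOfDegree
  obtain ⟨-, hle, -⟩ := hk.secondLargestEigenvalue_spec h.1 hsum hg0 hgt
  rw [heq] at hle
  have h1 := (hk.rayleigh_le h.1 hle hsum).2 hgt
  rw [hA, add_eq_left] at h1
  -- A pair at distance two is needed only for c₂ > 0.
  obtain ⟨w, -, hw⟩ := h.1.exists_dist_eq_of_le (x := x) (y := y) (m := G.dist x y - 2) (by omega)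
  have hc : 0 < c 2 := h.c_pos (x := w) (y := y) (n := 1) (by omega)
  have h2 := congrFun h1 z
  rw [Pi.smul_apply, Pi.zero_apply, smul_eq_mul, mul_eq_zero, hu] at h2
  have h3 := h2.resolve_left (by positivity)
  split_ifs at h3 <;> simp_all

/-- If vertices at distance at least four have the same second neighbours, then a distance-regular
graph of diameter at least four has diameter four and is antipodal. -/
theorem diam_eq_four_and_isAntipodal (h : G.IsDistanceRegularWith b c) (hD : 4 ≤ G.diam)
    (h2 : ∀ x y z : V, 4 ≤ G.dist x y → (G.dist z x = 2 ↔ G.dist z y = 2)) :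
    G.diam = 4 ∧ G.IsAntipodal := by
  have : Nonempty V := h.1.nonempty
  obtain ⟨x₀, y₀, h₀⟩ := G.exists_dist_eq_diam
  -- This vertex is at distance D - 2 from y₀, and the hypothesis makes that distance 2.
  obtain ⟨z₀, hxz, hzy⟩ := h.1.exists_dist_eq_of_le (x := x₀) (y := y₀) (m := 2) (by omega)
  have hz := (h2 x₀ y₀ z₀ (by omega)).mp (by rwa [dist_comm])
  have hdiam : G.diam = 4 := by omega
  refine ⟨hdiam, fun x => Or.inl rfl, fun hxy => ?_, ?_⟩
  · exact hxy.imp Eq.symm fun hd => by rwa [dist_comm]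
  intro x y z hxy hyz
  rcases hxy with rfl | hxy
  · exact hyz
  rcases hyz with rfl | hyz
  · exact Or.inr hxy
  rw [hdiam] at hxy hyz ⊢
  have hcomm : G.dist y x = 4 := by rwa [dist_comm]
  have hiff (w : V) : G.dist w x = 2 ↔ G.dist w z = 2 :=
    (h2 x y w hxy.ge).trans (h2 y z w hyz.ge)
  have hle := h.dist_le_diam x z
  obtain h0 | h1 | h2' | h3 | h4 : G.dist x z = 0 ∨ G.dist x z = 1 ∨ G.dist x z = 2 ∨
    G.dist x z = 3 ∨ G.dist x z = 4 := by omega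
  · exact Or.inl (h.1.dist_eq_zero_iff.mp h0)
  -- The vertex p shows b₁ > 0, so z has a neighbour w at distance 2 from x; but then d(w,z) would
  -- be 2.
  · obtain ⟨p, hp, hpy⟩ := h.1.exists_dist_eq_of_le (x := x) (y := y) (m := 2) (by omega)
    obtain ⟨w, hw, hxw⟩ := h.exists_adj_dist_add_one (x := x) (y := p) (u := x) (w := z) (by omega)
    rw [← dist_eq_one_iff_adj] at hw
    have := (hiff w).mp (by rw [dist_comm]; omega)
    rw [dist_comm] at this
    omega
  · have := (hiff x).mpr h2'
    simp at this
  · obtain ⟨u, hu, huz⟩ := h.1.exists_dist_eq_of_le (x := x) (y := z) (m := 1) (by omega)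
    have := (hiff u).mpr (by omega)
    rw [dist_comm] at this
    omega
  · exact Or.inr h4

section Antipodal

variable (h : G.IsDistanceRegularWith b c) (hD : G.diam = 4) (hA : G.IsAntipodal)

include h hD hA

/-- Antipodal vertices of an antipodal distance-regular graph of diameter four have the same second
neighbours. -/
theorem dist_eq_two_of_isAntipodal {x y z : V} (hxy : G.dist x y = 4) (hxz : G.dist x z = 2) :
    G.dist y z = 2 := by
  have htri := h.1.dist_triangle (u := x) (v := z) (w := y)
  rw [dist_comm (u := z)] at htri
  have hle := h.dist_le_diam y z
  obtain h2 | h3 | h4 : G.dist y z = 2 ∨ G.dist y z = 3 ∨ G.dist y z = 4 := by omega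
  · exact h2
  -- Here w and x would both be antipodal to y, although 1 ≤ d(x,w) ≤ 3.
  · obtain ⟨w, hw, hyw⟩ := h.exists_adj_dist_add_one (x := x) (y := y) (u := y) (w := z) (by omega)
    rw [← dist_eq_one_iff_adj] at hw
    have h1 := h.1.dist_triangle (u := x) (v := z) (w := w)
    have h2 := h.1.dist_triangle (u := x) (v := w) (w := z)
    rw [dist_comm (u := w)] at h2
    rcases hA.eq_or_dist_eq (x := y) (y := x) (z := w) (Or.inr (by rw [dist_comm, hxy, hD]))
      (Or.inr (by omega)) with rfl | h5
    · simp at h2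
      omega
    · omega
  · rcases hA.eq_or_dist_eq (x := y) (y := x) (z := z) (Or.inr (by rw [dist_comm, hxy, hD]))
      (Or.inr (by omega)) with rfl | h5
    · simp at hxz
    · omega

/-- In an antipodal distance-regular graph of diameter four, the balls of radius one around the
vertices of an antipodal class partition the set of vertices not at distance two from it. -/
theorem card_antipodal_near [DecidableEq V] (x z : V) :
    (((Finset.univ.filter fun y => y = x ∨ G.dist x y = 4).filter
      fun y => G.dist y z ≤ 1).card : ℝ) = if G.dist x z = 2 then 0 else 1 := by
  have : Nonempty V := h.1.nonempty
  split_ifs with hxz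
  · rw [Finset.filter_false_of_mem]
    · simp
    · intro y hy
      simp only [Finset.mem_filter_univ] at hy
      rcases hy with rfl | hy
      · omega
      · rw [h.dist_eq_two_of_isAntipodal hD hA hy hxz]
        omega
  · norm_cast
    rw [Finset.card_eq_one]
    obtain ⟨y, hy, hyz⟩ : ∃ y, (y = x ∨ G.dist x y = 4) ∧ G.dist y z ≤ 1 := by
      have hle := h.dist_le_diam x z
      obtain h1 | h3 | h4 : G.dist x z ≤ 1 ∨ G.dist x z = 3 ∨ G.dist x z = 4 := by omega
      · exact ⟨x, Or.inl rfl, h1⟩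
      · obtain ⟨x₀, y₀, h₀⟩ := G.exists_dist_eq_diam
        obtain ⟨y, hy, hxy⟩ := h.exists_adj_dist_add_one (x := x₀) (y := y₀) (u := x) (w := z)
          (by omega)
        exact ⟨y, Or.inr (by omega), (dist_eq_one_iff_adj.mpr hy.symm).le⟩
      · exact ⟨z, Or.inr h4, by simp⟩
    refine ⟨y, Finset.eq_singleton_iff_unique_mem.mpr ⟨by simp [hy, hyz], fun y' hy' => ?_⟩⟩
    rw [Finset.mem_filter, Finset.mem_filter_univ] at hy'
    rcases hA.eq_or_dist_eq (x := x) (y := y') (z := y) (hD ▸ hy'.1) (hD ▸ hy) with h5 | h5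
    · exact h5
    · have := h.1.dist_triangle (u := y') (v := z) (w := y)
      rw [dist_comm (u := z)] at this
      omega

/-- The eigenvalues other than the valency of an antipodal distance-regular graph of diameter four
are at most the positive root of `X ^ 2 - a₁ X - k`. -/
theorem eigenvalue_le_of_isAntipodal [DecidableEq V] {θ η : ℝ}
    (hθ : θ * (θ - intersectionA b c 1) = b 0) (hθ0 : 0 ≤ θ)
    (hpos : 0 < θ - intersectionA b c 1) (hη : G.IsGraphEigenvalue η) (hηk : η ≠ b 0) :
    η ≤ θ := by
  by_contra! hlt
  obtain ⟨v, hv0, hv⟩ := isGraphEigenvalue_iff.mp hη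
  have hsum := h.isRegularOfDegree.sum_eq_zero hv hηk
  set a : ℝ := (intersectionA b c 1 : ℝ)
  set q : ℝ := η ^ 2 - a * η - b 0 with hq
  have hqpos : 0 < q := by
    -- The other root of X² - a₁X - k is a₁ - θ, which is negative.
    have : q = (η - θ) * (η + (θ - a)) := by
      rw [hq, ← hθ]
      ring
    rw [this]
    exact mul_pos (by linarith) (by linarith)
  set s : V → ℝ := fun y => ∑ z, if G.dist y z = 2 then v z else 0 with hs
  have hqs (y : V) : q * v y = c 2 * s y := by
    have h1 := congrFun (congrArg (· *ᵥ v) h.adjMatrix_mul_self) y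
    simp only [← mulVec_mulVec, hv, mulVec_smul, add_mulVec, smul_mulVec, one_mulVec,
      Pi.add_apply, Pi.smul_apply, smul_eq_mul] at h1
    have h2 : (G.distTwoMatrix *ᵥ v) y = s y := by
      simp [hs, mulVec, dotProduct, distTwoMatrix_apply]
    rw [h2] at h1
    rw [hq]
    linarith
  have hball (y : V) : (1 + η) * v y = ∑ z, if G.dist y z ≤ 1 then v z else 0 := by
    have h1 := congrFun hv y
    rw [Pi.smul_apply, smul_eq_mul, mulVec, dotProduct] at h1
    have h2 : v y = ∑ z, if y = z then v z else 0 := by simp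
    rw [add_mul, one_mul, ← h1]
    nth_rewrite 1 [h2]
    rw [← Finset.sum_add_distrib]
    refine Finset.sum_congr rfl fun z _ => ?_
    rw [adjMatrix_apply, ite_mul, one_mul, zero_mul]
    simp only [← dist_eq_one_iff_adj, ← h.1.dist_eq_zero_iff (u := y) (v := z)]
    obtain h0 | h1 | h2 : G.dist y z = 0 ∨ G.dist y z = 1 ∨ 2 ≤ G.dist y z := by omega
    · simp only [h0]; norm_num
    · simp only [h1]; norm_num
    · rw [if_neg (by omega), if_neg (by omega), if_neg (by omega), add_zero]
  apply hv0
  ext x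
  set F : Finset V := Finset.univ.filter fun y => y = x ∨ G.dist x y = 4 with hF
  have hconst : ∀ y ∈ F, v y = v x := by
    intro y hy
    rw [hF, Finset.mem_filter_univ] at hy
    rcases hy with rfl | hy
    · rfl
    apply mul_left_cancel₀ hqpos.ne'
    rw [hqs, hqs]
    congr 1
    refine Finset.sum_congr rfl fun z _ => ?_
    have hiff : G.dist y z = 2 ↔ G.dist x z = 2 :=
      ⟨h.dist_eq_two_of_isAntipodal hD hA (by rwa [dist_comm]),
        h.dist_eq_two_of_isAntipodal hD hA hy⟩
    simp only [hiff]
  have hpart : ∑ z, v z = s x + F.card * ((1 + η) * v x) := by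
    have h1 : ∑ y ∈ F, (1 + η) * v y = ∑ z, (if G.dist x z = 2 then 0 else 1) * v z := by
      rw [Finset.sum_congr rfl fun y _ => hball y, Finset.sum_comm]
      refine Finset.sum_congr rfl fun z _ => ?_
      rw [← Finset.sum_filter, Finset.sum_const, nsmul_eq_mul, h.card_antipodal_near hD hA]
    rw [Finset.sum_congr rfl fun y hy => by rw [hconst y hy], Finset.sum_const,
      nsmul_eq_mul] at h1
    rw [h1, hs, ← Finset.sum_add_distrib]
    refine Finset.sum_congr rfl fun z _ => ?_
    split_ifs <;> simp
  -- Eliminate the sphere sum s x between q·v(x) = c₂·s(x) and the vanishing total sum.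
  have h1 : (q + c 2 * (F.card * (1 + η))) * v x = 0 := by
    rw [hsum] at hpart
    linear_combination hqs x - (c 2 : ℝ) * hpart
  have h2 : 0 < q + c 2 * (F.card * (1 + η)) := by
    have : 0 < 1 + η := by linarith
    positivity
  exact (mul_eq_zero.mp h1).resolve_left h2.ne'

end Antipodal

end IsDistanceRegularWith

end SimpleGraph

theorem proposition3p5 {V : Type*} [Fintype V] [DecidableEq V] (G : SimpleGraph V)
    [DecidableRel G.Adj] (b c : ℕ → ℕ) (hG : G.IsDistanceRegularWith b c) (hD : 3 ≤ G.diam) :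
    G.secondLargestEigenvalue =
        ((SimpleGraph.intersectionA b c 1 : ℝ) +
          √((SimpleGraph.intersectionA b c 1 : ℝ) ^ 2 + 4 * (b 0 : ℝ))) / 2 ↔
      (G.diam = 3 ∧ G.IsShilla) ∨ (G.diam = 4 ∧ G.IsAntipodal) := by
  have : Nonempty V := hG.1.nonempty
  obtain ⟨x, y, hxy⟩ := G.exists_dist_eq_diam
  obtain ⟨w, hw, -⟩ := hG.1.exists_dist_eq_of_le (x := x) (y := y) (m := 1) (by omega)
  rcases hD.eq_or_lt with h3 | h4
  · refine ⟨fun h => Or.inl ⟨h3.symm, b, c, hG, h3.symm, h⟩, ?_⟩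
    rintro (⟨-, b', c', hG', -, h⟩ | ⟨h4, -⟩)
    -- The Shilla witnesses may be other functions, but b₀, b₁ and c₁ are determined by counting at
    -- (x,x) and (x,w).
    · have hb0 : b' 0 = b 0 := by
        have h1 := (hG.2 x x).2
        have h2 := (hG'.2 x x).2
        rw [SimpleGraph.dist_self] at h1 h2
        exact h2.symm.trans h1
      have h1 := hG.2 x w
      have h2 := hG'.2 x w
      rw [hw] at h1 h2
      have hb1 : b' 1 = b 1 := h2.2.symm.trans h1.2
      have hc1 : c' 1 = c 1 := h2.1.symm.trans h1.1
      simpa only [SimpleGraph.intersectionA, hb0, hb1, hc1] using h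
    · omega
  have hk : (0 : ℝ) < b 0 := by
    have h1 := (hG.2 x x).2
    rw [SimpleGraph.dist_self] at h1
    rw [← h1]
    exact_mod_cast Finset.card_pos.mpr ⟨w, by simpa using SimpleGraph.dist_eq_one_iff_adj.mp hw⟩
  set a : ℝ := (SimpleGraph.intersectionA b c 1 : ℝ) with ha
  have hsq := Real.sq_sqrt (show 0 ≤ a ^ 2 + 4 * (b 0 : ℝ) by positivity)
  have habs : |a| < √(a ^ 2 + 4 * (b 0 : ℝ)) := by
    rw [← Real.sqrt_sq_eq_abs]
    exact Real.sqrt_lt_sqrt (sq_nonneg a) (by linarith)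
  set r := √(a ^ 2 + 4 * (b 0 : ℝ))
  rw [abs_lt] at habs
  set θ : ℝ := (a + r) / 2 with hθdef
  have hθ : θ * (θ - a) = b 0 := by
    rw [hθdef]
    linear_combination hsq / 4
  have hθ0 : 0 ≤ θ := by linarith
  have hpos : 0 < θ - a := by linarith
  constructor
  · intro heq
    exact Or.inr (hG.diam_eq_four_and_isAntipodal h4 fun x y z hd =>
      hG.dist_eq_two_iff_of_secondLargestEigenvalue_eq hθ hpos heq hd z)
  · rintro (⟨h3, -⟩ | ⟨hdiam, hA⟩)
    · omega
    obtain ⟨g, u, hsum, hgx, hAg, hgu, -⟩ :=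
      hG.exists_ball_difference hθ (show 4 ≤ G.dist x y by omega)
    have hg0 : g ≠ 0 := by
      rintro rfl
      simp only [Pi.zero_apply] at hgx
      linarith
    have hgt : g ⬝ᵥ (G.adjMatrix ℝ *ᵥ g) = θ * (g ⬝ᵥ g) := by
      rw [hAg, dotProduct_add, dotProduct_smul, dotProduct_smul, hgu]
      simp
    obtain ⟨⟨h1, h2⟩, -, hle⟩ :=
      hG.isRegularOfDegree.secondLargestEigenvalue_spec hG.1 hsum hg0 hgt
    exact le_antisymm (hG.eigenvalue_le_of_isAntipodal hdiam hA hθ hθ0 hpos h1 h2) hle
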